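/- Let $\mathbb{R}^2_{<}=\{(b,d)\in\mathbb{R}^2 : b<d\}$. A persistence diagram is a finite multiset $Y=\{(b_i,d_i)\}_{i=1}^N$ of points of $\mathbb{R}^2_<$; let $\mathsf{PDgm}$ be the set of all persistence diagrams and $\mathsf{PDgm}^0\subset\mathsf{PDgm}$ the subset of birth-zero diagrams, i.e. those of the form $\{(0,d_i)\}_{i=1}^N$. For $Y,Y'\in\mathsf{PDgm}$ define: - the bottleneck distance $$d_B(Y,Y')=\min_{\phi:S\to S'}\max\Big\{\max_{p\in S}\|p-\phi(p)\|_\infty,\ \max_{(b,d)\in Y\setminus S}\tfrac{d-b}{2},\ \max_{(b',d')\in Y'\setminus S'}\tfrac{d'-b'}{2}\Big\},$$ where $\phi$ ranges over all bijections between sub-multisets $S\subseteq Y$ and $S'\subseteq Y'$ (and the maximum over the empty set is $0$); - the erosion distance $d_E(Y,Y')$, the infimum of all $\varepsilon\ge 0$ such that $\mathrm{rank}[Y](b-\varepsilon,d+\varepsilon)\le\mathrm{rank}[Y'](b,d)$ and $\mathrm{rank}[Y'](b-\varepsilon,d+\varepsilon)\le\mathrm{rank}[Y](b,d)$ for all $b\le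 d$, where for $b\le d$ the number $\mathrm{rank}[Y](b,d)$ counts (with multiplicity) the points $(b_i,d_i)\in Y$ with $b_i\le b\le d<d_i$; - the landscape distance $d_L(Y,Y')=\sup_{k\ge 1,\,t\in\mathbb{R}}|\lambda^Y_k(t)-\lambda^{Y'}_k(t)|$, where $\lambda^Y_k(t)=\sup\{h\ge 0 : \mathrm{rank}[Y](t-h,t+h)\ge k\}$ (and $\sup\emptyset=0$). A map $f:(X,d_X)\to(H,d_H)$ is a coarse embedding if there are non-decreasing functions $\rho^-,\rho^+:[0,\infty)\to[0,\infty)$ with $\lim_{t\to\infty}\rho^-(t)=\infty$ and $$\rho^-(d_X(x,x'))\le d_H(f(x),f(x'))\le\rho^+(d_X(x,x'))\quad\text{for all }x,x'\in X.$$ **Theorem (Coarse Non-Embeddability in Hilbert Spaces).** One has $d_B=d_E=d_L$ on $\mathsf{PDgm}^0$ and $d_E=d_L$ on $\mathsf{PDgm}$. The space $\mathsf{PDgm}^0$ with the distance $d_B=d_E=d_L$ does not admit a coarse embedding into any (real or complex) Hilbert space. Consequently, neither $(\mathsf{PDgm},d_B)$ nor $(\mathsf{PDgm},d_E)=(\mathsf{PDgm},d_L)$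 admits a coarse embedding into a Hilbert space. -/

import Mathlib

/-- Birth-death pairs: the points `(b, d)` of the plane with `b < d`. -/
abbrev BirthDeathPair : Type := {p : ℝ × ℝ // p.1 < p.2}

namespace BirthDeathPair

def birth (p : BirthDeathPair) : ℝ := p.1.1

def death (p : BirthDeathPair) : ℝ := p.1.2

/-- The `ℓ^∞` distance between two birth-death pairs. -/
def dInfty (p q : BirthDeathPair) : ℝ :=
  max |p.birth - q.birth| |p.death - q.death|

end BirthDeathPair

/-- A persistence diagram is a finite multiset of birth-death pairs. -/
abbrev PDgm : Type := Multiset BirthDeathPair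

/-- Birth-zero diagrams: all points are of the form `(0, d)` (with `d > 0`). -/
abbrev PDgmZero : Type := {Y : PDgm // ∀ p ∈ Y, p.birth = 0}

/-- A bijection between a sub-multiset `S` of `Y` and a sub-multiset `S'` of `Y'`: `matched` is its
graph, and the points of `Y` outside `S` and of `Y'` outside `S'` are the unmatched points. -/
structure PartialMatching (Y Y' : PDgm) where
  matched : Multiset (BirthDeathPair × BirthDeathPair)
  unmatchedLeft : Multiset BirthDeathPair
  unmatchedRight : Multiset BirthDeathPair
  left_eq : matched.map Prod.fst + unmatchedLeft = Y
  right_eq : matched.map Prod.snd + unmatchedRight = Y'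

/-- The maximum of a finite multiset of non-negative reals, with value `0` on the empty one. -/
noncomputable def multisetMax (s : Multiset ℝ) : ℝ := s.fold max 0

/-- The cost of a partial matching: the largest of the distances between matched points and of the
half-persistences of unmatched points. -/
noncomputable def PartialMatching.cost {Y Y' : PDgm} (φ : PartialMatching Y Y') : ℝ :=
  max (multisetMax (φ.matched.map fun m => m.1.dInfty m.2))
    (max (multisetMax (φ.unmatchedLeft.map fun p => (p.death - p.birth) / 2))
      (multisetMax (φ.unmatchedRight.map fun p => (p.death - p.birth) / 2)))

/-- The bottleneck distance: the smallest cost of a partial matching. (There are only finitely many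
partial matchings and at least one, so the infimum is a minimum.) -/
noncomputable def bottleneckDist (Y Y' : PDgm) : ℝ :=
  ⨅ φ : PartialMatching Y Y', φ.cost

/-- The rank function: the number of points `(b_i, d_i)` of `Y`, with multiplicity, such that
`b_i ≤ b ≤ d < d_i`. -/
noncomputable def rankFn (Y : PDgm) (b d : ℝ) : ℕ :=
  Y.countP fun p => p.birth ≤ b ∧ b ≤ d ∧ d < p.death

/-- The erosion distance. -/
noncomputable def erosionDist (Y Y' : PDgm) : ℝ :=
  sInf {ε : ℝ | 0 ≤ ε ∧ ∀ b d : ℝ, b ≤ d →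
    rankFn Y (b - ε) (d + ε) ≤ rankFn Y' b d ∧ rankFn Y' (b - ε) (d + ε) ≤ rankFn Y b d}

/-- The `k`-th landscape function of `Y`, for `k = 1, 2, …`. (The set is bounded as `k ≥ 1`; where it
is empty, the supremum is `0`.) -/
noncomputable def landscape (Y : PDgm) (k : ℕ+) (t : ℝ) : ℝ :=
  sSup {h : ℝ | 0 ≤ h ∧ (k : ℕ) ≤ rankFn Y (t - h) (t + h)}

/-- The landscape distance: the sup-norm distance of the landscapes. -/
noncomputable def landscapeDist (Y Y' : PDgm) : ℝ :=
  ⨆ p : ℕ+ × ℝ, |landscape Y p.1 p.2 - landscape Y' p.1 p.2|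

/-- The map `f` is a coarse embedding of `X` with distance `dX` into the metric space `H`. The control
functions are maps from `[0, ∞)` to `[0, ∞)`: only their values on `[0, ∞)` are constrained. -/
def IsCoarseEmbedding {X H : Type*} [MetricSpace H] (dX : X → X → ℝ) (f : X → H) : Prop :=
  ∃ ρlow ρup : ℝ → ℝ,
    Set.MapsTo ρlow (Set.Ici 0) (Set.Ici 0) ∧ Set.MapsTo ρup (Set.Ici 0) (Set.Ici 0) ∧
    MonotoneOn ρlow (Set.Ici 0) ∧ MonotoneOn ρup (Set.Ici 0) ∧
    Filter.Tendsto ρlow Filter.atTop Filter.atTop ∧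
    ∀ x x' : X, ρlow (dX x x') ≤ dist (f x) (f x') ∧ dist (f x) (f x') ≤ ρup (dX x x')

/-!
**The distances.** An `ε`-interleaving of rank functions shifts every landscape function by at most
`ε`, and conversely the landscapes determine the rank function up to an arbitrarily small loss in `ε`;
hence `erosionDist_eq_landscapeDist`. The erosion distance is at most the bottleneck distance on all
diagrams, because points that are counted by the eroded rank function are too persistent to be left
unmatched. For birth-zero diagrams, where a diagram is just a list of deaths, matching the points in
descending order of their deaths gives the converse inequality (`bottleneckDist_eq_erosionDist`).

**The obstruction.** A map `f` from a discrete torus `(ℤ/2R)^N` to a Hilbert space satisfies a metric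
cotype inequality (`CubeAverage.exists_norm_sub_le_of_cube`): if `N ≥ R ^ 2` and `f` moves points at
`ℓ^∞` distance `1` by at most `K`, then it moves some pair of antipodal points of one of the
coordinate circles, which have distance `R`, by at most `4 * K`. To see this, let `g x` be the average
of `f` over the `2 ^ N` vertices of the unit cube at `x`. It is within `K` of `f`. Averaging over the
`N` directions one by one, the parallelogram law shows that the energies of all the differences of `g`
in the coordinate directions together are at most four times the energy that is lost between `f` and
`g`, and this loss is the variance of `f` over a cube, at most `K ^ 2` on average. So in one of the
`N` directions unit steps move `g` by at most `2 * K / √N` in mean square, and `R` steps by at most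
`2 * R * K / √N ≤ 2 * K`.

**The embedding.** The torus with its `ℓ^∞` metric embeds into some `ℓ^∞` space by recording the
distances of all coordinates to all points of the circle, and bounded subsets of finite-dimensional
`ℓ^∞` spaces embed isometrically into the birth-zero diagrams, by using well-separated deaths, one for
each coordinate (`staircase`). Hence the lower control function of a coarse embedding would be
bounded by `4 * ρup 1` at all natural numbers.
-/

/-! ### Partial matchings and interleavings of rank functions -/

namespace PersistenceDiagram

open BirthDeathPair

lemma multisetMax_le_iff {s : Multiset ℝ} {a : ℝ} :
    multisetMax s ≤ a ↔ 0 ≤ a ∧ ∀ x ∈ s, x ≤ a := by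
  induction s using Multiset.induction_on with
  | empty => simp [multisetMax]
  | cons x s ih =>
    have h : multisetMax (x ::ₘ s) = max x (multisetMax s) := Multiset.fold_cons_left ..
    rw [h, max_le_iff, ih]
    simp only [Multiset.mem_cons, forall_eq_or_imp]
    tauto

lemma cost_le_iff {Y Y' : PDgm} (φ : PartialMatching Y Y') {ε : ℝ} :
    φ.cost ≤ ε ↔ 0 ≤ ε ∧ (∀ m ∈ φ.matched, m.1.dInfty m.2 ≤ ε) ∧
      (∀ p ∈ φ.unmatchedLeft, (p.death - p.birth) / 2 ≤ ε) ∧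
      ∀ p ∈ φ.unmatchedRight, (p.death - p.birth) / 2 ≤ ε := by
  rw [PartialMatching.cost, max_le_iff, max_le_iff, multisetMax_le_iff, multisetMax_le_iff,
    multisetMax_le_iff]
  simp only [Multiset.mem_map, forall_exists_index, and_imp, forall_apply_eq_imp_iff₂]
  tauto

lemma cost_nonneg {Y Y' : PDgm} (φ : PartialMatching Y Y') : 0 ≤ φ.cost :=
  ((cost_le_iff φ).1 le_rfl).1

instance (Y Y' : PDgm) : Nonempty (PartialMatching Y Y') :=
  ⟨⟨0, Y, Y', by simp, by simp⟩⟩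

lemma bottleneckDist_le {Y Y' : PDgm} (φ : PartialMatching Y Y') {ε : ℝ} (h : φ.cost ≤ ε) :
    bottleneckDist Y Y' ≤ ε :=
  (ciInf_le ⟨0, by rintro _ ⟨ψ, rfl⟩; exact cost_nonneg ψ⟩ φ).trans h

lemma bottleneckDist_nonneg (Y Y' : PDgm) : 0 ≤ bottleneckDist Y Y' :=
  le_ciInf cost_nonneg

/-- `Y` and `Y'` are `ε`-interleaved on the level of rank functions: `ε` is one of the numbers whose
infimum is the erosion distance. -/
def RankInterleaved (Y Y' : PDgm) (ε : ℝ) : Prop :=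
  0 ≤ ε ∧ ∀ b d : ℝ, b ≤ d →
    rankFn Y (b - ε) (d + ε) ≤ rankFn Y' b d ∧ rankFn Y' (b - ε) (d + ε) ≤ rankFn Y b d

lemma RankInterleaved.symm {Y Y' : PDgm} {ε : ℝ} (h : RankInterleaved Y Y' ε) :
    RankInterleaved Y' Y ε :=
  ⟨h.1, fun b d hbd => (h.2 b d hbd).symm⟩

lemma erosionDist_le {Y Y' : PDgm} {ε : ℝ} (h : RankInterleaved Y Y' ε) :
    erosionDist Y Y' ≤ ε :=
  csInf_le ⟨0, fun _ hx => hx.1⟩ h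

lemma countP_le_countP {α : Type*} {s : Multiset α} {p q : α → Prop} [DecidablePred p]
    [DecidablePred q] (h : ∀ a ∈ s, p a → q a) : s.countP p ≤ s.countP q := by
  induction s using Quotient.inductionOn with
  | h l =>
    simp only [Multiset.quot_mk_to_coe, Multiset.coe_countP]
    exact List.countP_mono_left fun x hx hp => by
      simpa using h x (by simpa using hx) (by simpa using hp)

/-- A partial matching of cost at most `ε` carries the points counted by the eroded rank of `Y`
injectively to points counted by the rank of `Y'`, because the former are too persistent to be
unmatched. -/
lemma rankFn_le_of_matching {M : Multiset (BirthDeathPair × BirthDeathPair)}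
    {U U' : Multiset BirthDeathPair} {ε : ℝ} (hM : ∀ m ∈ M, m.1.dInfty m.2 ≤ ε)
    (hU : ∀ p ∈ U, (p.death - p.birth) / 2 ≤ ε) {b d : ℝ} (hbd : b ≤ d) :
    rankFn (M.map Prod.fst + U) (b - ε) (d + ε) ≤ rankFn (M.map Prod.snd + U') b d := by
  rw [rankFn, rankFn, Multiset.countP_add, Multiset.countP_add]
  have hU0 : U.countP (fun p => p.birth ≤ b - ε ∧ b - ε ≤ d + ε ∧ d + ε < p.death) = 0 := by
    rw [Multiset.countP_eq_zero]
    rintro p hp ⟨h1, -, h3⟩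
    have := hU p hp
    linarith
  rw [hU0, add_zero]
  refine le_trans ?_ (Nat.le_add_right _ _)
  rw [Multiset.countP_map, Multiset.countP_map, ← Multiset.countP_eq_card_filter,
    ← Multiset.countP_eq_card_filter]
  refine countP_le_countP fun m hm => ?_
  rintro ⟨h1, -, h3⟩
  have h := max_le_iff.1 (hM m hm)
  have hb := abs_le.1 h.1
  have hd := abs_le.1 h.2
  exact ⟨by linarith, hbd, by linarith⟩

lemma dInfty_comm (p q : BirthDeathPair) : p.dInfty q = q.dInfty p := by
  simp only [dInfty, abs_sub_comm]

lemma rankInterleaved_of_cost_le {Y Y' : PDgm} (φ : PartialMatching Y Y') {ε : ℝ}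
    (h : φ.cost ≤ ε) : RankInterleaved Y Y' ε := by
  obtain ⟨M, U, U', rfl, rfl⟩ := φ
  obtain ⟨hε, hM, hU, hU'⟩ := (cost_le_iff _).1 h
  refine ⟨hε, fun b d hbd => ⟨rankFn_le_of_matching hM hU hbd, ?_⟩⟩
  have := rankFn_le_of_matching (M := M.map Prod.swap) (U := U') (U' := U)
    (fun m hm => by
      obtain ⟨m₀, hm₀, rfl⟩ := Multiset.mem_map.1 hm
      rw [dInfty_comm]
      exact hM m₀ hm₀) hU' hbd
  simpa [Multiset.map_map, Function.comp_def] using this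

/-- Stability of the rank function. -/
theorem erosionDist_le_bottleneckDist (Y Y' : PDgm) : erosionDist Y Y' ≤ bottleneckDist Y Y' :=
  le_ciInf fun φ => erosionDist_le (rankInterleaved_of_cost_le φ le_rfl)

lemma exists_rankInterleaved (Y Y' : PDgm) : {ε | RankInterleaved Y Y' ε}.Nonempty :=
  let φ : PartialMatching Y Y' := Classical.arbitrary _
  ⟨φ.cost, rankInterleaved_of_cost_le φ le_rfl⟩

/-! ### Erosion distance and landscape distance -/

lemma rankFn_anti {Y : PDgm} {b d b' d' : ℝ} (hb : b ≤ b') (hbd : b' ≤ d') (hd : d' ≤ d) :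
    rankFn Y b d ≤ rankFn Y b' d' :=
  countP_le_countP fun _ _ h => ⟨h.1.trans hb, hbd, hd.trans_lt h.2.2⟩

/-- The set whose supremum is `landscape Y k t`. -/
def landscapeSet (Y : PDgm) (k : ℕ+) (t : ℝ) : Set ℝ :=
  {h : ℝ | 0 ≤ h ∧ (k : ℕ) ≤ rankFn Y (t - h) (t + h)}

lemma bddAbove_landscapeSet (Y : PDgm) (k : ℕ+) (t : ℝ) : BddAbove (landscapeSet Y k t) := by
  refine ⟨multisetMax (Y.map fun p => p.death - t), ?_⟩
  rintro h ⟨-, hk⟩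
  have hpos : 0 < rankFn Y (t - h) (t + h) := k.pos.trans_le hk
  obtain ⟨p, hp, -, -, hd⟩ := Multiset.countP_pos.1 hpos
  have := (multisetMax_le_iff.1 (le_refl (multisetMax (Y.map fun p => p.death - t)))).2
    (p.death - t) (Multiset.mem_map_of_mem _ hp)
  linarith

lemma landscape_nonneg (Y : PDgm) (k : ℕ+) (t : ℝ) : 0 ≤ landscape Y k t :=
  Real.sSup_nonneg fun _ hx => hx.1

lemma le_landscape {Y : PDgm} {k : ℕ+} {t h : ℝ} (hk : (k : ℕ) ≤ rankFn Y (t - h) (t + h)) :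
    h ≤ landscape Y k t := by
  rcases lt_or_ge h 0 with h0 | h0
  · exact h0.le.trans (landscape_nonneg Y k t)
  · exact le_csSup (bddAbove_landscapeSet Y k t) ⟨h0, hk⟩

lemma le_rankFn_of_lt_landscape {Y : PDgm} {k : ℕ+} {t h : ℝ} (h0 : 0 ≤ h)
    (hlt : h < landscape Y k t) : (k : ℕ) ≤ rankFn Y (t - h) (t + h) := by
  have hne : (landscapeSet Y k t).Nonempty := by
    by_contra hne
    rw [Set.not_nonempty_iff_eq_empty] at hne
    have : landscape Y k t = 0 := by
      rw [landscape, ← landscapeSet, hne, Real.sSup_empty]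
    linarith
  obtain ⟨h', ⟨-, hk⟩, hh'⟩ := exists_lt_of_lt_csSup hne hlt
  exact hk.trans (rankFn_anti (by linarith) (by linarith) (by linarith))

lemma landscape_le_add {Y Y' : PDgm} {ε : ℝ} (h : RankInterleaved Y Y' ε) (k : ℕ+) (t : ℝ) :
    landscape Y k t ≤ landscape Y' k t + ε := by
  refine Real.sSup_le ?_ (add_nonneg (landscape_nonneg Y' k t) h.1)
  rintro x ⟨-, hk⟩
  rcases lt_or_ge x ε with hx | hx
  · linarith [landscape_nonneg Y' k t]
  · have h1 := (h.2 (t - (x - ε)) (t + (x - ε)) (by linarith)).1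
    rw [show t - (x - ε) - ε = t - x by ring, show t + (x - ε) + ε = t + x by ring] at h1
    linarith [le_landscape (hk.trans h1)]

lemma abs_landscape_sub_le {Y Y' : PDgm} {ε : ℝ} (h : RankInterleaved Y Y' ε) (p : ℕ+ × ℝ) :
    |landscape Y p.1 p.2 - landscape Y' p.1 p.2| ≤ ε :=
  abs_le.2 ⟨by linarith [landscape_le_add h.symm p.1 p.2], by
    linarith [landscape_le_add h p.1 p.2]⟩

lemma rankFn_le_of_landscape_lt {Y Y' : PDgm} {ε : ℝ}
    (h : ∀ k t, landscape Y k t < landscape Y' k t + ε) {b d : ℝ} (hbd : b ≤ d) :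
    rankFn Y (b - ε) (d + ε) ≤ rankFn Y' b d := by
  rcases Nat.eq_zero_or_pos (rankFn Y (b - ε) (d + ε)) with h0 | hpos
  · omega
  · set k : ℕ+ := ⟨_, hpos⟩
    have h1 : (d - b) / 2 + ε ≤ landscape Y k ((b + d) / 2) := by
      refine le_landscape (le_of_eq ?_)
      rw [show (b + d) / 2 - ((d - b) / 2 + ε) = b - ε by ring,
        show (b + d) / 2 + ((d - b) / 2 + ε) = d + ε by ring]
      rfl
    have h2 := le_rankFn_of_lt_landscape (Y := Y') (k := k) (t := (b + d) / 2) (h := (d - b) / 2)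
      (by linarith) (by linarith [h k ((b + d) / 2)])
    rw [show (b + d) / 2 - (d - b) / 2 = b by ring,
      show (b + d) / 2 + (d - b) / 2 = d by ring] at h2
    exact h2

theorem erosionDist_eq_landscapeDist (Y Y' : PDgm) : erosionDist Y Y' = landscapeDist Y Y' := by
  refine le_antisymm (le_of_forall_gt fun ε hε => ?_) ?_
  · have hbdd : BddAbove (Set.range fun p : ℕ+ × ℝ =>
        |landscape Y p.1 p.2 - landscape Y' p.1 p.2|) := by
      obtain ⟨δ, hδ⟩ := exists_rankInterleaved Y Y'
      exact ⟨δ, by rintro _ ⟨p, rfl⟩; exact abs_landscape_sub_le hδ p⟩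
    have h0 : 0 ≤ landscapeDist Y Y' := Real.iSup_nonneg fun _ => abs_nonneg _
    obtain ⟨δ, hδ, hδε⟩ := exists_between hε
    have hlt : ∀ k t, |landscape Y k t - landscape Y' k t| < δ := fun k t =>
      (le_ciSup hbdd (k, t)).trans_lt hδ
    refine (erosionDist_le ⟨h0.trans hδ.le, fun b d hbd => ⟨?_, ?_⟩⟩).trans_lt hδε
    · exact rankFn_le_of_landscape_lt (fun k t => by linarith [(abs_lt.1 (hlt k t)).2]) hbd
    · exact rankFn_le_of_landscape_lt (fun k t => by linarith [(abs_lt.1 (hlt k t)).1]) hbd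
  · exact le_csInf (exists_rankInterleaved Y Y') fun ε hε =>
      ciSup_le fun p => abs_landscape_sub_le hε p

/-! ### Birth-zero diagrams -/

lemma rankFn_of_birth_eq_zero {Y : PDgm} (hY : ∀ p ∈ Y, p.birth = 0) {b d : ℝ} (hb : 0 ≤ b)
    (hbd : b ≤ d) : rankFn Y b d = Y.countP fun p => d < p.death :=
  Multiset.countP_congr rfl fun p hp => by simp [hY p hp, hb, hbd]

lemma exists_pairwise_death_ge (Y : PDgm) :
    ∃ l : List BirthDeathPair, (l : Multiset BirthDeathPair) = Y ∧
      l.Pairwise fun p q => q.death ≤ p.death := by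
  let r : BirthDeathPair → BirthDeathPair → Prop := fun p q => q.death ≤ p.death
  have : Std.Total r := ⟨fun p q => le_total _ _⟩
  have : IsTrans BirthDeathPair r := ⟨fun p q s h h' => h'.trans h⟩
  refine ⟨Y.toList.insertionSort r, ?_, List.pairwise_insertionSort r _⟩
  rw [Multiset.coe_eq_coe.2 (List.perm_insertionSort r _), Multiset.coe_toList]

lemma lt_countP_death_iff {l : List BirthDeathPair} (hl : l.Pairwise fun p q => q.death ≤ p.death)
    {d : ℝ} {k : ℕ} :
    k < (l : Multiset BirthDeathPair).countP (fun p => d < p.death) ↔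
      ∃ h : k < l.length, d < l[k].death := by
  induction l generalizing k with
  | nil => simp
  | cons p l ih =>
    rw [List.pairwise_cons] at hl
    rw [← Multiset.cons_coe, Multiset.countP_cons]
    split_ifs with hp
    · cases k with
      | zero => simp [hp]
      | succ k =>
        rw [Nat.succ_lt_succ_iff, ih hl.2]
        simp
    · have h0 : (l : Multiset BirthDeathPair).countP (fun p => d < p.death) = 0 := by
        rw [Multiset.countP_eq_zero]
        intro q hq
        have := hl.1 q (by simpa using hq)
        linarith
      rw [h0]
      constructor
      · intro h
        omega
      · rintro ⟨h, hk⟩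
        cases k with
        | zero => exact absurd hk hp
        | succ k =>
          have hkl : k < l.length := by simpa using h
          have := hl.1 l[k] (List.getElem_mem hkl)
          simp only [List.getElem_cons_succ] at hk
          linarith

/-- In the lists of points sorted by descending death, if the `k`-th death of one diagram is above
`2 * ε`, then the `k`-th death of the other exists and is smaller by at most `ε`. The threshold stems
from the eroded rank being tested only at pairs with `b ≥ ε`, hence `d ≥ ε`: below, it vanishes. -/
lemma RankInterleaved.death_sub_le {l l' : List BirthDeathPair}
    (hl : l.Pairwise fun p q => q.death ≤ p.death)
    (hl' : l'.Pairwise fun p q => q.death ≤ p.death) (h0 : ∀ p ∈ l, p.birth = 0)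
    (h0' : ∀ p ∈ l', p.birth = 0) {ε : ℝ} (h : RankInterleaved (l : PDgm) l' ε) {k : ℕ}
    (hk : k < l.length) (hkε : 2 * ε < l[k].death) :
    ∃ hk' : k < l'.length, l[k].death - ε ≤ l'[k].death := by
  have key : ∀ d, ε ≤ d → d + ε < l[k].death → ∃ hk' : k < l'.length, d < l'[k].death := by
    intro d hd hlt
    rw [← lt_countP_death_iff hl', ← rankFn_of_birth_eq_zero (Y := l') (by simpa using h0') h.1 hd]
    refine lt_of_lt_of_le ?_ (h.2 ε d hd).1
    rw [rankFn_of_birth_eq_zero (Y := l) (by simpa using h0) (by simp) (by linarith [h.1]),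
      lt_countP_death_iff hl]
    exact ⟨hk, hlt⟩
  obtain ⟨hk', -⟩ := key ε le_rfl (by linarith)
  refine ⟨hk', le_of_forall_lt fun d hd => ?_⟩
  rcases le_total ε d with hεd | hεd
  · exact (key d hεd (by linarith)).2
  · exact hεd.trans_lt (key ε le_rfl (by linarith)).2

/-- For birth-zero diagrams, an interleaving of rank functions comes from matching the points in the
order of their deaths, down to the last death above `2 * ε` of either diagram. -/
lemma RankInterleaved.bottleneckDist_le {Y Y' : PDgm} (hY : ∀ p ∈ Y, p.birth = 0)
    (hY' : ∀ p ∈ Y', p.birth = 0) {ε : ℝ} (h : RankInterleaved Y Y' ε) :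
    bottleneckDist Y Y' ≤ ε := by
  obtain ⟨l, rfl, hl⟩ := exists_pairwise_death_ge Y
  obtain ⟨l', rfl, hl'⟩ := exists_pairwise_death_ge Y'
  have h0 : ∀ p ∈ l, p.birth = 0 := by simpa using hY
  have h0' : ∀ p ∈ l', p.birth = 0 := by simpa using hY'
  set n := (l : PDgm).countP fun p => 2 * ε < p.death
  set n' := (l' : PDgm).countP fun p => 2 * ε < p.death
  have large : ∀ k, k < max n n' → ∃ (hk : k < l.length) (hk' : k < l'.length),
      |l[k].death - l'[k].death| ≤ ε := by
    intro k hk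
    rcases lt_max_iff.1 hk with hk | hk
    · obtain ⟨hk, hkε⟩ := (lt_countP_death_iff hl).1 hk
      obtain ⟨hk', hle⟩ := h.death_sub_le hl hl' h0 h0' hk hkε
      refine ⟨hk, hk', abs_le.2 ⟨?_, by linarith⟩⟩
      rcases lt_or_ge (2 * ε) l'[k].death with hlt | hge
      · obtain ⟨_, hle'⟩ := h.symm.death_sub_le hl' hl h0' h0 hk' hlt
        linarith
      · linarith [h.1]
    · obtain ⟨hk', hkε⟩ := (lt_countP_death_iff hl').1 hk
      obtain ⟨hk, hle⟩ := h.symm.death_sub_le hl' hl h0' h0 hk' hkε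
      refine ⟨hk, hk', abs_le.2 ⟨by linarith, ?_⟩⟩
      rcases lt_or_ge (2 * ε) l[k].death with hlt | hge
      · obtain ⟨_, hle'⟩ := h.death_sub_le hl hl' h0 h0' hk hlt
        linarith
      · linarith [h.1]
  have small : ∀ {m : List BirthDeathPair} {N : ℕ}, m.Pairwise (fun p q => q.death ≤ p.death) →
      (m : PDgm).countP (fun p => 2 * ε < p.death) ≤ N → (∀ p ∈ m, p.birth = 0) →
      ∀ p ∈ m.drop N, (p.death - p.birth) / 2 ≤ ε := by
    intro m N hm hN hm0 p hp
    rw [hm0 p (List.mem_of_mem_drop hp)]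
    obtain ⟨i, hi, rfl⟩ := List.getElem_of_mem hp
    rw [List.getElem_drop]
    by_contra! hlt
    have hi' : N + i < m.length := by
      rw [List.length_drop] at hi
      omega
    have := (lt_countP_death_iff hm (d := 2 * ε) (k := N + i)).2 ⟨hi', by linarith⟩
    omega
  have hlen : max n n' ≤ l.length := le_of_forall_lt fun k hk => (large k hk).1
  have hlen' : max n n' ≤ l'.length := le_of_forall_lt fun k hk => (large k hk).2.1
  let φ : PartialMatching (l : PDgm) l' :=
    { matched := ((l.take (max n n')).zip (l'.take (max n n')) : List _)
      unmatchedLeft := (l.drop (max n n') : List _)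
      unmatchedRight := (l'.drop (max n n') : List _)
      left_eq := by
        rw [Multiset.map_coe, List.map_fst_zip (by simp [hlen, hlen']), Multiset.coe_add,
          List.take_append_drop]
      right_eq := by
        rw [Multiset.map_coe, List.map_snd_zip (by simp [hlen, hlen']), Multiset.coe_add,
          List.take_append_drop] }
  refine PersistenceDiagram.bottleneckDist_le φ ((cost_le_iff φ).2 ⟨h.1, ?_, ?_, ?_⟩)
  · intro m hm
    obtain ⟨i, hi, rfl⟩ := List.getElem_of_mem (Multiset.mem_coe.1 hm)
    have hi' : i < max n n' := by
      simp only [List.length_zip, List.length_take] at hi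
      omega
    obtain ⟨hk, hk', hle⟩ := large i hi'
    simp only [List.getElem_zip, List.getElem_take, dInfty]
    rw [h0 _ (List.getElem_mem hk), h0' _ (List.getElem_mem hk')]
    simpa using max_le h.1 hle
  · exact fun p hp => small hl (le_max_left _ _) h0 p (Multiset.mem_coe.1 hp)
  · exact fun p hp => small hl' (le_max_right _ _) h0' p (Multiset.mem_coe.1 hp)

theorem bottleneckDist_eq_erosionDist {Y Y' : PDgm} (hY : ∀ p ∈ Y, p.birth = 0)
    (hY' : ∀ p ∈ Y', p.birth = 0) : bottleneckDist Y Y' = erosionDist Y Y' :=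
  le_antisymm (le_csInf (exists_rankInterleaved Y Y') fun _ hε =>
      RankInterleaved.bottleneckDist_le hY hY' hε)
    (erosionDist_le_bottleneckDist Y Y')

end PersistenceDiagram

/-! ### A metric cotype inequality for maps to Hilbert spaces -/

namespace CubeAverage

open Finset

section

variable {G : Type*} [AddCommGroup G] [Fintype G]

lemma sum_add_right_eq {M : Type*} [AddCommMonoid M] (u : G → M) (a : G) :
    ∑ x, u (x + a) = ∑ x, u x :=
  Equiv.sum_comp (Equiv.addRight a) u

lemma sum_norm_sq_nsmul_sub_le {E : Type*} [NormedAddCommGroup E] (u : G → E) (a : G) (R : ℕ) :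
    ∑ x, ‖u (x + R • a) - u x‖ ^ 2 ≤ R ^ 2 * ∑ x, ‖u (x + a) - u x‖ ^ 2 := by
  have h : ∀ x, ‖u (x + R • a) - u x‖ ^ 2
      ≤ R * ∑ r ∈ range R, ‖u (x + r • a + a) - u (x + r • a)‖ ^ 2 := fun x => by
    have tel := sum_range_sub (fun r : ℕ => u (x + r • a)) R
    simp only [zero_smul, add_zero, succ_nsmul, ← add_assoc] at tel
    rw [← tel]
    refine (pow_le_pow_left₀ (norm_nonneg _) (norm_sum_le _ _) 2).trans ?_
    simpa using sq_sum_le_card_mul_sum_sq (s := range R)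
      (f := fun r => ‖u (x + r • a + a) - u (x + r • a)‖)
  refine (sum_le_sum fun x _ => h x).trans (le_of_eq ?_)
  rw [← mul_sum, sum_comm]
  simp_rw [sum_add_right_eq (fun x => ‖u (x + a) - u x‖ ^ 2)]
  simp
  ring

end

variable {G ι H : Type*} [AddCommGroup G] [NormedAddCommGroup H] [InnerProductSpace ℝ H]

/-- The average of `f` over the vertices `x + ∑ i ∈ s, e i`, `s ⊆ t`, of the cube based at `x` whose
edge directions are the `e i` with `i ∈ t`. -/
noncomputable def cubeAvg (e : ι → G) (f : G → H) (t : Finset ι) (x : G) : H :=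
  ((2 : ℝ) ^ #t)⁻¹ • ∑ s ∈ t.powerset, f (x + ∑ i ∈ s, e i)

lemma cubeAvg_empty (e : ι → G) (f : G → H) (x : G) : cubeAvg e f ∅ x = f x := by
  simp [cubeAvg]

lemma cubeAvg_insert [DecidableEq ι] (e : ι → G) (f : G → H) {t : Finset ι} {i : ι} (hi : i ∉ t)
    (x : G) :
    cubeAvg e f (insert i t) x = (2 : ℝ)⁻¹ • (cubeAvg e f t x + cubeAvg e f t (x + e i)) := by
  have key : ∑ s ∈ t.powerset, f (x + ∑ j ∈ insert i s, e j)
      = ∑ s ∈ t.powerset, f (x + e i + ∑ j ∈ s, e j) := by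
    refine sum_congr rfl fun s hs => ?_
    rw [sum_insert fun h => hi (mem_powerset.1 hs h), add_assoc]
  rw [cubeAvg, sum_powerset_insert hi, key, card_insert_of_notMem hi, cubeAvg, cubeAvg,
    ← smul_add, smul_smul, pow_succ, mul_inv, mul_comm]

lemma norm_cubeAvg_sub_le (e : ι → G) (f : G → H) (t : Finset ι) {K : ℝ} {x : G}
    (hK : ∀ s, ‖f (x + ∑ i ∈ s, e i) - f x‖ ≤ K) : ‖cubeAvg e f t x - f x‖ ≤ K := by
  have h2 : (0 : ℝ) < 2 ^ #t := by positivity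
  have h : cubeAvg e f t x - f x
      = ((2 : ℝ) ^ #t)⁻¹ • ∑ s ∈ t.powerset, (f (x + ∑ i ∈ s, e i) - f x) := by
    rw [sum_sub_distrib, smul_sub, sum_const, card_powerset, ← Nat.cast_smul_eq_nsmul ℝ, smul_smul]
    push_cast
    rw [inv_mul_cancel₀ h2.ne', one_smul, cubeAvg]
  rw [h, norm_smul, norm_inv, Real.norm_of_nonneg h2.le, inv_mul_le_iff₀ h2]
  refine (norm_sum_le_of_le _ fun s _ => hK s).trans ?_
  simp

variable [Fintype G]

/-- The parallelogram law, summed over a finite group. -/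
lemma sum_norm_sq_midpoint (u : G → H) (a : G) :
    ∑ x, ‖(2 : ℝ)⁻¹ • (u x + u (x + a))‖ ^ 2
      = ∑ x, ‖u x‖ ^ 2 - 4⁻¹ * ∑ x, ‖u (x + a) - u x‖ ^ 2 := by
  have h : ∀ x, ‖(2 : ℝ)⁻¹ • (u x + u (x + a))‖ ^ 2
      = 2⁻¹ * ‖u x‖ ^ 2 + 2⁻¹ * ‖u (x + a)‖ ^ 2 - 4⁻¹ * ‖u (x + a) - u x‖ ^ 2 := fun x => by
    have := parallelogram_law_with_norm ℝ (u (x + a)) (u x)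
    rw [norm_smul, mul_pow, add_comm (u x)]
    norm_num
    linarith
  simp_rw [h, sum_sub_distrib, sum_add_distrib, ← mul_sum]
  rw [sum_add_right_eq (fun x => ‖u x‖ ^ 2) a]
  ring

/-- Averaging over a cube loses at least a quarter of the energy of the differences of the average in
the directions of the cube: adding the direction `e i` loses a quarter of the energy of the difference
of the previous average in this direction, and averaging only decreases such energies. -/
lemma sum_energy_cubeAvg_le (e : ι → G) (f : G → H) (t : Finset ι) :
    4⁻¹ * ∑ i ∈ t, ∑ x, ‖cubeAvg e f t (x + e i) - cubeAvg e f t x‖ ^ 2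
      ≤ ∑ x, ‖f x‖ ^ 2 - ∑ x, ‖cubeAvg e f t x‖ ^ 2 := by
  classical
  induction t using Finset.induction_on with
  | empty => simp [cubeAvg_empty]
  | insert i t hi ih =>
    have contr : ∀ j, ∑ x, ‖cubeAvg e f (insert i t) (x + e j) - cubeAvg e f (insert i t) x‖ ^ 2
        ≤ ∑ x, ‖cubeAvg e f t (x + e j) - cubeAvg e f t x‖ ^ 2 := fun j => by
      have h := sum_norm_sq_midpoint (fun x => cubeAvg e f t (x + e j) - cubeAvg e f t x) (e i)
      have h0 : 0 ≤ ∑ x, ‖(cubeAvg e f t (x + e i + e j) - cubeAvg e f t (x + e i))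
          - (cubeAvg e f t (x + e j) - cubeAvg e f t x)‖ ^ 2 := sum_nonneg fun _ _ => by positivity
      refine le_trans (le_of_eq ?_) (h.le.trans (by linarith))
      refine sum_congr rfl fun x _ => ?_
      rw [cubeAvg_insert e f hi, cubeAvg_insert e f hi, ← smul_sub, add_right_comm x (e j) (e i)]
      congr 3
      abel
    have step : ∑ x, ‖cubeAvg e f (insert i t) x‖ ^ 2 = ∑ x, ‖cubeAvg e f t x‖ ^ 2
        - 4⁻¹ * ∑ x, ‖cubeAvg e f t (x + e i) - cubeAvg e f t x‖ ^ 2 := by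
      simp_rw [cubeAvg_insert e f hi]
      exact sum_norm_sq_midpoint _ _
    rw [sum_insert hi, step]
    have h1 := contr i
    have h2 := sum_le_sum fun j (_ : j ∈ t) => contr j
    linarith

/-- The loss of energy is the variance of `f` over the cube, hence small if `f` varies little
there. -/
lemma sum_norm_sq_sub_cubeAvg_le (e : ι → G) (f : G → H) (t : Finset ι) {K : ℝ}
    (hK : ∀ x s, ‖f (x + ∑ i ∈ s, e i) - f x‖ ≤ K) :
    ∑ x, ‖f x‖ ^ 2 - ∑ x, ‖cubeAvg e f t x‖ ^ 2 ≤ Fintype.card G * K ^ 2 := by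
  have h2 : (0 : ℝ) < 2 ^ #t := by positivity
  -- the mean minimises the mean square distance
  have var : ∀ x, ∑ s ∈ t.powerset, ‖f (x + ∑ i ∈ s, e i)‖ ^ 2 - 2 ^ #t * ‖cubeAvg e f t x‖ ^ 2
      ≤ 2 ^ #t * K ^ 2 := fun x => by
    have hs : ∑ s ∈ t.powerset, f (x + ∑ i ∈ s, e i) = (2 : ℝ) ^ #t • cubeAvg e f t x := by
      rw [cubeAvg, smul_smul, mul_inv_cancel₀ h2.ne', one_smul]
    have expand : ∑ s ∈ t.powerset, ‖f (x + ∑ i ∈ s, e i) - f x‖ ^ 2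
        = ∑ s ∈ t.powerset, ‖f (x + ∑ i ∈ s, e i)‖ ^ 2
          - 2 * (2 ^ #t * inner ℝ (cubeAvg e f t x) (f x)) + 2 ^ #t * ‖f x‖ ^ 2 := by
      simp_rw [norm_sub_sq_real]
      rw [sum_add_distrib, sum_sub_distrib, ← mul_sum, ← sum_inner, hs, real_inner_smul_left]
      simp
    have bound : ∑ s ∈ t.powerset, ‖f (x + ∑ i ∈ s, e i) - f x‖ ^ 2 ≤ 2 ^ #t * K ^ 2 := by
      refine (sum_le_sum fun s _ => pow_le_pow_left₀ (norm_nonneg _) (hK x s) 2).trans ?_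
      simp
    have sq := norm_sub_sq_real (cubeAvg e f t x) (f x)
    have sq0 : 0 ≤ (2 : ℝ) ^ #t * ‖cubeAvg e f t x - f x‖ ^ 2 := by positivity
    rw [sq] at sq0
    linarith
  have tot := sum_le_sum fun x (_ : x ∈ (univ : Finset G)) => var x
  rw [sum_sub_distrib, sum_comm] at tot
  simp_rw [sum_add_right_eq (fun x => ‖f x‖ ^ 2)] at tot
  rw [← mul_sum] at tot
  simp only [sum_const, card_powerset, nsmul_eq_mul, Nat.cast_pow, Nat.cast_ofNat, card_univ] at tot
  refine le_of_mul_le_mul_left ?_ h2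
  linarith

/-- If a map to a Hilbert space moves the vertices of each cube at most `K` away from its base vertex,
and the cube has dimension at least `R ^ 2`, then in one of the directions some pair of points `R`
steps apart is moved by at most `4 * K`. -/
theorem exists_norm_sub_le_of_cube [Fintype ι] (e : ι → G) (f : G → H) {K : ℝ} {R : ℕ} (hR : 0 < R)
    (hcard : R ^ 2 ≤ Fintype.card ι) (hK : ∀ x s, ‖f (x + ∑ i ∈ s, e i) - f x‖ ≤ K) :
    ∃ x i, ‖f (x + R • e i) - f x‖ ≤ 4 * K := by
  have hK0 : 0 ≤ K := (norm_nonneg _).trans (hK 0 ∅)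
  set g := cubeAvg e f univ with hg
  have key : ∃ i : ι, ∃ x, ‖g (x + R • e i) - g x‖ ≤ 2 * K := by
    by_contra! hcon
    have lower : ∀ i, Fintype.card G * (2 * K) ^ 2 < ∑ x, ‖g (x + R • e i) - g x‖ ^ 2 := fun i => by
      have : ∑ _x : G, (2 * K) ^ 2 < ∑ x, ‖g (x + R • e i) - g x‖ ^ 2 :=
        sum_lt_sum_of_nonempty univ_nonempty fun x _ =>
          pow_lt_pow_left₀ (hcon i x) (by positivity) two_ne_zero
      simpa using this
    have hι : (univ : Finset ι).Nonempty := by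
      rw [← card_pos, card_univ]
      exact lt_of_lt_of_le (by positivity) hcard
    have low := sum_lt_sum_of_nonempty hι fun i _ => lower i
    have up := sum_le_sum fun i (_ : i ∈ (univ : Finset ι)) => sum_norm_sq_nsmul_sub_le g (e i) R
    rw [← mul_sum] at up
    have en := (sum_energy_cubeAvg_le e f univ).trans (sum_norm_sq_sub_cubeAvg_le e f univ hK)
    rw [← hg] at en
    simp only [sum_const, card_univ, nsmul_eq_mul] at low
    have hR2 : (R : ℝ) ^ 2 ≤ Fintype.card ι := by exact_mod_cast hcard
    have h1 : (R : ℝ) ^ 2 * ∑ i, ∑ x, ‖g (x + e i) - g x‖ ^ 2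
        ≤ R ^ 2 * (4 * (Fintype.card G * K ^ 2)) := by gcongr; linarith
    have h2 : (R : ℝ) ^ 2 * (4 * (Fintype.card G * K ^ 2))
        ≤ Fintype.card ι * (4 * (Fintype.card G * K ^ 2)) := by gcongr
    nlinarith
  obtain ⟨i, x, hx⟩ := key
  refine ⟨x, i, ?_⟩
  have h1 := norm_cubeAvg_sub_le e f univ (hK (x + R • e i))
  have h2 := norm_cubeAvg_sub_le e f univ (hK x)
  rw [← hg] at h1 h2
  have h : f (x + R • e i) - f x
      = -(g (x + R • e i) - f (x + R • e i)) + (g (x + R • e i) - g x) + (g x - f x) := by abel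
  rw [h]
  refine (norm_add₃_le).trans ?_
  rw [norm_neg]
  linarith

end CubeAverage

/-! ### Discrete tori in the space of birth-zero diagrams -/
namespace PersistenceDiagram

open BirthDeathPair Finset

/-- The length of the shortest arc from `0` to `z` in the cycle `ZMod n`. -/
def arcLength {n : ℕ} (z : ZMod n) : ℕ := z.valMinAbs.natAbs

lemma arcLength_add_le {n : ℕ} (z w : ZMod n) : arcLength (z + w) ≤ arcLength z + arcLength w :=
  (ZMod.natAbs_valMinAbs_add_le z w).trans (Int.natAbs_add_le _ _)

lemma arcLength_neg {n : ℕ} (z : ZMod n) : arcLength (-z) = arcLength z :=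
  ZMod.natAbs_valMinAbs_neg z

lemma arcLength_natCast {n a : ℕ} (h : a ≤ n / 2) : arcLength (a : ZMod n) = a := by
  rw [arcLength, ZMod.valMinAbs_natCast_of_le_half h, Int.natAbs_natCast]

lemma arcLength_le {n : ℕ} [NeZero n] (z : ZMod n) : arcLength z ≤ n / 2 :=
  ZMod.natAbs_valMinAbs_le z

section Staircase

variable {I : Type*} [Fintype I]

/-- The point of the diagram `staircase R c` that encodes the coordinate `c i`. -/
noncomputable def staircasePoint (R : ℕ) (c : I → ℕ) (i : I) : BirthDeathPair :=
  ⟨(0, 4 * (R + 1) * (Fintype.equivFin I i + 1) + c i), by positivity⟩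

/-- The birth-zero diagram that encodes a vector `c` with entries in `{0, …, R}`. The deaths lie in
pairwise disjoint windows, one for each coordinate, that are far from each other and from `0` compared
to `R`, so that no matching of cost below `R` can do better than comparing the coordinates. -/
noncomputable def staircase (R : ℕ) (c : I → ℕ) : PDgmZero :=
  ⟨univ.val.map (staircasePoint R c), by
    intro p hp
    obtain ⟨i, -, rfl⟩ := Multiset.mem_map.1 hp
    rfl⟩

lemma bottleneckDist_staircase_le (R : ℕ) {c c' : I → ℕ} {K : ℝ} (hK : 0 ≤ K)
    (h : ∀ i, |(c i : ℝ) - c' i| ≤ K) :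
    bottleneckDist (staircase R c).1 (staircase R c').1 ≤ K := by
  refine bottleneckDist_le
    { matched := univ.val.map fun i => (staircasePoint R c i, staircasePoint R c' i)
      unmatchedLeft := 0
      unmatchedRight := 0
      left_eq := by simp [Multiset.map_map, staircase]
      right_eq := by simp [Multiset.map_map, staircase] } ?_
  refine (cost_le_iff _).2 ⟨hK, ?_, by simp, by simp⟩
  intro m hm
  obtain ⟨i, -, rfl⟩ := Multiset.mem_map.1 hm
  simpa [dInfty, staircasePoint, birth, death] using max_le hK (h i)

lemma rankFn_staircase (R : ℕ) (c : I → ℕ) {b d : ℝ} (hb : 0 ≤ b) (hbd : b ≤ d) :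
    rankFn (staircase R c).1 b d
      = #{i | d < 4 * (R + 1) * ((Fintype.equivFin I i : ℕ) + 1) + c i} := by
  rw [rankFn_of_birth_eq_zero (staircase R c).2 hb hbd, staircase, Multiset.countP_map]
  rfl

lemma le_bottleneckDist_staircase {R : ℕ} {c c' : I → ℕ} (hc : ∀ i, c i ≤ R) {i : I}
    (hi : c i = 0) (hi' : c' i = R) :
    (R : ℝ) ≤ bottleneckDist (staircase R c).1 (staircase R c').1 := by
  refine le_trans ?_ (erosionDist_le_bottleneckDist _ _)
  refine le_csInf (exists_rankInterleaved _ _) fun ε hε => ?_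
  by_contra! hlt
  have hε0 := hε.1
  set e := Fintype.equivFin I
  -- test the ranks at the death that encodes the coordinate `i` of `c`
  set d : ℝ := 4 * (R + 1) * ((e i : ℕ) + 1) with hd
  have hdR : (R : ℝ) ≤ d := by
    have : (0 : ℝ) ≤ R * (e i : ℕ) := by positivity
    have : (0 : ℝ) ≤ (e i : ℕ) := by positivity
    rw [hd]
    nlinarith
  have h := (hε.2 ε d (by linarith)).2
  rw [sub_self, rankFn_staircase R c' le_rfl (by linarith),
    rankFn_staircase R c hε0 (by linarith)] at h
  refine absurd h (not_le.2 (card_lt_card ((ssubset_iff_of_subset ?_).2 ⟨i, ?_, ?_⟩)))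
  · intro j hj
    rw [mem_filter] at hj ⊢
    refine ⟨mem_univ j, ?_⟩
    have hcj : (c j : ℝ) ≤ R := by exact_mod_cast hc j
    have hR : (0 : ℝ) ≤ R := by positivity
    rcases lt_trichotomy (e j) (e i) with hji | hji | hji
    · have hji' : ((e j : ℕ) : ℝ) + 1 ≤ (e i : ℕ) := by exact_mod_cast hji
      have := mul_le_mul_of_nonneg_left hji' (show (0 : ℝ) ≤ 4 * (R + 1) by positivity)
      rw [hd] at hj
      linarith [hj.2]
    · have := e.injective hji
      subst this
      rw [hi']
      linarith
    · have hji' : ((e i : ℕ) : ℝ) + 1 ≤ (e j : ℕ) := by exact_mod_cast hji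
      have := mul_le_mul_of_nonneg_left hji' (show (0 : ℝ) ≤ 4 * (R + 1) by positivity)
      have : (0 : ℝ) ≤ c' j := by positivity
      rw [hd]
      linarith
  · rw [mem_filter, hi']
    exact ⟨mem_univ i, by linarith⟩
  · rw [mem_filter, hi]
    simp [hd, e]

end Staircase

/-- The distances of the coordinates of `x` to all points of the cycle: the product of the Kuratowski
embeddings of the coordinate cycles, isometric for the maximum distances. -/
def torusCoords {R N : ℕ} (x : Fin N → ZMod (2 * R)) (i : Fin N × ZMod (2 * R)) : ℕ :=
  arcLength (x i.1 - i.2)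

/-- A map of birth-zero diagrams to a Hilbert space that moves diagrams at bottleneck distance at most
`1` by at most `K` moves, for each `R`, some diagrams at distance at least `R` by at most `4 * K`. -/
theorem exists_far_norm_sub_le {H : Type*} [NormedAddCommGroup H] [InnerProductSpace ℝ H]
    (f : PDgmZero → H) {K : ℝ}
    (hK : ∀ Y Y' : PDgmZero, bottleneckDist Y.1 Y'.1 ≤ 1 → ‖f Y - f Y'‖ ≤ K) {R : ℕ} (hR : 0 < R) :
    ∃ Y Y' : PDgmZero, (R : ℝ) ≤ bottleneckDist Y.1 Y'.1 ∧ ‖f Y - f Y'‖ ≤ 4 * K := by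
  have : NeZero (2 * R) := ⟨by omega⟩
  let Φ : (Fin (R ^ 2) → ZMod (2 * R)) → PDgmZero := fun x => staircase R (torusCoords x)
  have hle : ∀ (x : Fin (R ^ 2) → ZMod (2 * R)) i, torusCoords x i ≤ R := fun x i =>
    (arcLength_le _).trans (by omega)
  have hcube : ∀ x s, ‖f (Φ (x + ∑ j ∈ s, Pi.single j 1)) - f (Φ x)‖ ≤ K := by
    intro x s
    refine hK _ _ (bottleneckDist_staircase_le R zero_le_one fun i => ?_)
    -- a step by `0` or `1` in the cycle changes arc lengths by at most `1`
    have hstep : arcLength ((∑ j ∈ s, (Pi.single j 1 : Fin (R ^ 2) → ZMod (2 * R))) i.1) ≤ 1 := by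
      have h0 : arcLength (0 : ZMod (2 * R)) = 0 := by
        simpa using arcLength_natCast (n := 2 * R) (Nat.zero_le _)
      have h1 : arcLength (1 : ZMod (2 * R)) = 1 := by
        simpa using arcLength_natCast (n := 2 * R) (a := 1) (by omega)
      rw [Finset.sum_apply, Finset.sum_pi_single]
      split_ifs
      · exact h1.le
      · exact h0.le.trans zero_le_one
    set w := (∑ j ∈ s, (Pi.single j 1 : Fin (R ^ 2) → ZMod (2 * R))) i.1 with hw
    have e1 : torusCoords (x + ∑ j ∈ s, Pi.single j 1) i = arcLength (x i.1 - i.2 + w) := by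
      rw [torusCoords, Pi.add_apply, hw, add_sub_right_comm]
    have h1 := arcLength_add_le (x i.1 - i.2) w
    have h2 := arcLength_add_le (x i.1 - i.2 + w) (-w)
    rw [add_neg_cancel_right, arcLength_neg] at h2
    have h1' : torusCoords (x + ∑ j ∈ s, Pi.single j 1) i ≤ torusCoords x i + 1 := by
      rw [e1, torusCoords]
      omega
    have h2' : torusCoords x i ≤ torusCoords (x + ∑ j ∈ s, Pi.single j 1) i + 1 := by
      rw [e1, torusCoords]
      omega
    have h1r : ((torusCoords (x + ∑ j ∈ s, Pi.single j 1) i : ℕ) : ℝ) ≤ torusCoords x i + 1 := by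
      exact_mod_cast h1'
    have h2r : (torusCoords x i : ℝ) ≤ (torusCoords (x + ∑ j ∈ s, Pi.single j 1) i : ℕ) + 1 := by
      exact_mod_cast h2'
    exact abs_le.2 ⟨by linarith, by linarith⟩
  obtain ⟨x, j, hx⟩ := CubeAverage.exists_norm_sub_le_of_cube
    (fun j : Fin (R ^ 2) => (Pi.single j 1 : Fin (R ^ 2) → ZMod (2 * R))) (fun x => f (Φ x)) (K := K)
    hR (by simp) hcube
  refine ⟨Φ x, Φ (x + R • Pi.single j 1), ?_, by rwa [norm_sub_rev]⟩
  refine le_bottleneckDist_staircase (hle x) (i := (j, x j)) ?_ ?_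
  · simpa [torusCoords] using arcLength_natCast (n := 2 * R) (Nat.zero_le _)
  · simpa [torusCoords] using arcLength_natCast (n := 2 * R) (a := R) (by omega)

/-! ### Coarse embeddings -/

theorem not_isCoarseEmbedding_bottleneckDist {H : Type*} [NormedAddCommGroup H]
    [InnerProductSpace ℝ H] (f : PDgmZero → H) :
    ¬ IsCoarseEmbedding (fun Y Y' : PDgmZero => bottleneckDist Y.1 Y'.1) f := by
  rintro ⟨ρlow, ρup, -, -, hlow, hup, hlim, hf⟩
  obtain ⟨R, hR⟩ := (((Filter.tendsto_atTop.1 hlim (4 * ρup 1 + 1)).natCast_atTop).and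
    (Filter.eventually_gt_atTop 0)).exists
  obtain ⟨Y, Y', hfar, hnear⟩ := exists_far_norm_sub_le f (K := ρup 1) (fun Y Y' h => by
    rw [← dist_eq_norm]
    exact (hf Y Y').2.trans (hup (bottleneckDist_nonneg _ _) (Set.mem_Ici.2 zero_le_one) h)) hR.2
  have h1 := hlow (Set.mem_Ici.2 (Nat.cast_nonneg R)) (bottleneckDist_nonneg _ _) hfar
  have h2 := (hf Y Y').1
  rw [dist_eq_norm] at h2
  linarith [hR.1]

lemma IsCoarseEmbedding.comp {X X' H : Type*} [MetricSpace H] {d : X → X → ℝ} {f : X → H}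
    (hf : IsCoarseEmbedding d f) (g : X' → X) :
    IsCoarseEmbedding (fun x x' => d (g x) (g x')) (f ∘ g) := by
  obtain ⟨ρlow, ρup, h1, h2, h3, h4, h5, h⟩ := hf
  exact ⟨ρlow, ρup, h1, h2, h3, h4, h5, fun x x' => h (g x) (g x')⟩

end PersistenceDiagram

open PersistenceDiagram in
theorem mainTheorem7 {𝕜 : Type*} [RCLike 𝕜] {H : Type*} [NormedAddCommGroup H]
    [InnerProductSpace 𝕜 H] [CompleteSpace H] :
    -- the distances agree: all three on birth-zero diagrams, the last two on all diagrams
    (∀ Y Y' : PDgmZero, bottleneckDist Y.1 Y'.1 = erosionDist Y.1 Y'.1 ∧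
      erosionDist Y.1 Y'.1 = landscapeDist Y.1 Y'.1) ∧
    (∀ Y Y' : PDgm, erosionDist Y Y' = landscapeDist Y Y') ∧
    -- no coarse embedding of the space of birth-zero diagrams
    (¬ ∃ f : PDgmZero → H, IsCoarseEmbedding (fun Y Y' => bottleneckDist Y.1 Y'.1) f) ∧
    (¬ ∃ f : PDgmZero → H, IsCoarseEmbedding (fun Y Y' => erosionDist Y.1 Y'.1) f) ∧
    (¬ ∃ f : PDgmZero → H, IsCoarseEmbedding (fun Y Y' => landscapeDist Y.1 Y'.1) f) ∧
    -- no coarse embedding of the space of all diagrams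
    (¬ ∃ f : PDgm → H, IsCoarseEmbedding bottleneckDist f) ∧
    (¬ ∃ f : PDgm → H, IsCoarseEmbedding erosionDist f) ∧
    (¬ ∃ f : PDgm → H, IsCoarseEmbedding landscapeDist f) := by
  -- only the norm of `H` enters the notion of coarse embedding, so real scalars suffice
  let _ : InnerProductSpace ℝ H := InnerProductSpace.rclikeToReal 𝕜 H
  have hBE : (fun Y Y' : PDgmZero => bottleneckDist Y.1 Y'.1)
      = fun Y Y' => erosionDist Y.1 Y'.1 :=
    funext₂ fun Y Y' => bottleneckDist_eq_erosionDist Y.2 Y'.2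
  have hEL : erosionDist = landscapeDist := funext₂ erosionDist_eq_landscapeDist
  have hB : ¬ ∃ f : PDgmZero → H, IsCoarseEmbedding (fun Y Y' => bottleneckDist Y.1 Y'.1) f :=
    fun ⟨f, hf⟩ => not_isCoarseEmbedding_bottleneckDist f hf
  have hE : ¬ ∃ f : PDgmZero → H, IsCoarseEmbedding (fun Y Y' => erosionDist Y.1 Y'.1) f :=
    hBE ▸ hB
  have hE' : ¬ ∃ f : PDgm → H, IsCoarseEmbedding erosionDist f :=
    fun ⟨f, hf⟩ => hE ⟨_, IsCoarseEmbedding.comp hf Subtype.val⟩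
  exact ⟨fun Y Y' => ⟨bottleneckDist_eq_erosionDist Y.2 Y'.2, erosionDist_eq_landscapeDist _ _⟩,
    erosionDist_eq_landscapeDist, hB, hE, hEL ▸ hE,
    fun ⟨f, hf⟩ => hB ⟨_, IsCoarseEmbedding.comp hf Subtype.val⟩, hE', hEL ▸ hE'⟩
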